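/- Let $K$ be a field and $x\in K$. For a sequence $(a(n))_{n\ge 0}$ in $K$ put $r(n,x)=\sum_{k=0}^{n}a(n-k)x^k$ and $d(n,x)=\det\bigl(r(i+j,x)\bigr)_{i,j=0}^{n}$, with the convention $x^0=1$, so that $d(n,0)=\det\bigl(a(i+j)\bigr)_{i,j=0}^{n}$. Let $F_n(y,s)$ be the bivariate Fibonacci polynomials, $F_0(y,s)=0$, $F_1(y,s)=1$, $F_n(y,s)=yF_{n-1}(y,s)+sF_{n-2}(y,s)$ for $n\ge 2$. (i) Let $u\in K$ and let $f(z)=\sum_{n\ge0}M_n(u)z^n\in K[[z]]$ be the (unique) formal power series with $f=1+uzf+z^2f^2$. Then for $a(n)=M_n(u)$ and every $n\ge 0$ we have $d(n,0)\ne 0$ and $$\frac{d(n,x)}{d(n,0)}=(-1)^n\bigl(F_{n+1}(u,-1)F_{n+1}(x-u,-1)+F_{n+2}(u,-1)F_n(x-u,-1)\bigr).$$ (ii) For the Motzkin numbers $a(n)=M_n=M_n(1)$, that is $(M_n)_{n\ge0}=(1,1,2,4,9,21,51,127,\dots)$ (regarded as elements of $K$), and every $n\ge 0$, $$d(3n,x)=F_{3n}(x-1,-1)+F_{3n+1}(x-1,-1),$$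 $$d(3n+1,x)=d(3n+2,x)=-F_{3n+2}(x-1,-1).$$ -/

import Mathlib

/-- The bivariate Fibonacci polynomials: `F 0 = 0`, `F 1 = 1` and
`F n = x * F (n-1) + s * F (n-2)` for `n ≥ 2`. -/
def bivFib {R : Type*} [CommSemiring R] (x s : R) : ℕ → R
  | 0 => 0
  | 1 => 1
  | n + 2 => x * bivFib x s (n + 1) + s * bivFib x s n

/-- `r(n, x) = ∑_{k=0}^n a(n-k) x^k`. -/
def convPoly {R : Type*} [CommSemiring R] (a : ℕ → R) (n : ℕ) (x : R) : R :=
  ∑ k ∈ Finset.range (n + 1), a (n - k) * x ^ k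

/-- `d(n, x)`, the determinant of the `(n+1) × (n+1)` Hankel matrix `(r(i+j, x))_{i,j=0}^n`. -/
def hankelDet {R : Type*} [CommRing R] (a : ℕ → R) (n : ℕ) (x : R) : R :=
  (Matrix.of fun i j : Fin (n + 1) => convPoly a ((i : ℕ) + (j : ℕ)) x).det

/-- The moments `M_n(u)`: the sequence with `M_0(u) = 1` and, for `n ≥ 0`,
`M_{n+1}(u) = u * M_n(u) + ∑_{i+j=n-1} M_i(u) M_j(u)` (an empty sum for `n = 0`). -/
def motzkinMoment {R : Type*} [CommSemiring R] (u : R) : ℕ → R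
  | 0 => 1
  | n + 1 => u * motzkinMoment u n +
      ∑ i : Fin n, motzkinMoment u i * motzkinMoment u (n - 1 - i)

/-- The Motzkin numbers `1, 1, 2, 4, 9, 21, 51, 127, …`, i.e. `M_n = M_n(1)`. -/
def motzkinNumber (n : ℕ) : ℕ := motzkinMoment 1 n

/-- The equation `f = 1 + u z f + z² f²` has exactly one power series solution, and its
coefficients are the `M_n(u)`. -/
theorem eq_mk_motzkinMoment_iff {R : Type*} [CommSemiring R] (u : R) (f : PowerSeries R) :
    f = 1 + PowerSeries.C u * PowerSeries.X * f + PowerSeries.X ^ 2 * f ^ 2 ↔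
      f = PowerSeries.mk (motzkinMoment u) := by
  have key : ∀ g : PowerSeries R,
      g = 1 + PowerSeries.C u * PowerSeries.X * g + PowerSeries.X ^ 2 * g ^ 2 ↔
        PowerSeries.coeff 0 g = 1 ∧ ∀ n, PowerSeries.coeff (n + 1) g =
          u * PowerSeries.coeff n g +
          ∑ i : Fin n, PowerSeries.coeff i g * PowerSeries.coeff (n - 1 - i) g := by
    intro g
    have h0 : PowerSeries.coeff 0
        (1 + PowerSeries.C u * PowerSeries.X * g + PowerSeries.X ^ 2 * g ^ 2) = 1 := by
      simp
    have h1 : ∀ n, PowerSeries.coeff (n + 1)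
        (1 + PowerSeries.C u * PowerSeries.X * g + PowerSeries.X ^ 2 * g ^ 2) =
          u * PowerSeries.coeff n g +
          ∑ i : Fin n, PowerSeries.coeff i g * PowerSeries.coeff (n - 1 - i) g := by
      intro n
      have hq : PowerSeries.coeff (n + 1) (PowerSeries.X ^ 2 * g ^ 2) =
          ∑ i : Fin n, PowerSeries.coeff i g * PowerSeries.coeff (n - 1 - i) g := by
        rw [pow_two PowerSeries.X, mul_assoc, PowerSeries.coeff_succ_X_mul]
        cases n with
        | zero => simp
        | succ m =>
          rw [PowerSeries.coeff_succ_X_mul, pow_two, PowerSeries.coeff_mul,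
            Finset.Nat.sum_antidiagonal_eq_sum_range_succ
              (fun i j => PowerSeries.coeff i g * PowerSeries.coeff j g),
            Finset.sum_range]
          simp
      rw [map_add, map_add, hq, mul_assoc, PowerSeries.coeff_C_mul,
        PowerSeries.coeff_succ_X_mul, PowerSeries.coeff_one, if_neg (Nat.succ_ne_zero n), zero_add]
    constructor
    · intro h
      exact ⟨(congrArg (PowerSeries.coeff 0) h).trans h0,
        fun n => (congrArg (PowerSeries.coeff (n + 1)) h).trans (h1 n)⟩
    · rintro ⟨ha, hb⟩
      ext n
      cases n with
      | zero => rw [h0, ha]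
      | succ n => rw [h1, hb]
  rw [key]
  constructor
  · rintro ⟨ha, hb⟩
    ext n
    rw [PowerSeries.coeff_mk]
    induction n using Nat.strong_induction_on with
    | _ n ih =>
      cases n with
      | zero => rw [ha, motzkinMoment]
      | succ n =>
        rw [hb, motzkinMoment, ih n (Nat.lt_succ_self n)]
        congr 1
        refine Finset.sum_congr rfl fun i _ => ?_
        rw [ih i (by omega), ih (n - 1 - i) (by omega)]
  · rintro rfl
    refine ⟨?_, fun n => ?_⟩
    · rw [PowerSeries.coeff_mk, motzkinMoment]
    · simp only [PowerSeries.coeff_mk]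
      rw [motzkinMoment]

/-! The lower unitriangular array A of coefficients of z^k f^(k+1) has rows evolving by the
symmetric tridiagonal matrix J with u on the diagonal and 1 beside it; symmetry makes A Aᵀ the
Hankel matrix of the moments. Since r(m+1,x) = a(m+1) + x r(m,x), subtracting x times the preceding
row turns every row but the first of (r(i+j,x)) into a row of A Aᵀ. The first row is cAᵀ, where c is
`motzkinConvCoord`. So d(n,x) = det C, with C equal to A except for the first row c. The vector p =
`motzkinOrthoAtZero` satisfies Jp = 0, so rows 1 to n of A annihilate it; hence det C = ∑ c_k p_k,
which telescopes to the Fibonacci expression. At x = 0 only c_0 p_0 = 1 survives. -/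

/-- The entry `(n, k)` of the Motzkin triangle attached to a power series `f`. -/
noncomputable def motzkinTriangle {R : Type*} [CommRing R] (f : PowerSeries R) (n k : ℕ) : R :=
  PowerSeries.coeff n (PowerSeries.X ^ k * f ^ (k + 1))

/-! ### The triangle and its tridiagonal recurrence -/

section Triangle

variable {R : Type*} [CommRing R] {u : R} {f : PowerSeries R}

theorem motzkinTriangle_zero_right (n : ℕ) :
    motzkinTriangle f n 0 = PowerSeries.coeff n f := by
  simp [motzkinTriangle]

theorem motzkinTriangle_eq_zero_of_lt {n k : ℕ} (h : n < k) : motzkinTriangle f n k = 0 := by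
  rw [motzkinTriangle, PowerSeries.coeff_X_pow_mul', if_neg (by omega)]

theorem constantCoeff_of_motzkin_equation
    (hf : f = 1 + PowerSeries.C u * PowerSeries.X * f + PowerSeries.X ^ 2 * f ^ 2) :
    PowerSeries.constantCoeff f = 1 := by
  rw [hf]; simp

theorem motzkinTriangle_self
    (hf : f = 1 + PowerSeries.C u * PowerSeries.X * f + PowerSeries.X ^ 2 * f ^ 2) (n : ℕ) :
    motzkinTriangle f n n = 1 := by
  rw [motzkinTriangle, PowerSeries.coeff_X_pow_mul', if_pos le_rfl, Nat.sub_self,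
    PowerSeries.coeff_zero_eq_constantCoeff_apply, map_pow,
    constantCoeff_of_motzkin_equation hf, one_pow]

theorem motzkinTriangle_succ_zero
    (hf : f = 1 + PowerSeries.C u * PowerSeries.X * f + PowerSeries.X ^ 2 * f ^ 2) (n : ℕ) :
    motzkinTriangle f (n + 1) 0 = u * motzkinTriangle f n 0 + motzkinTriangle f n 1 := by
  have h : PowerSeries.X ^ 0 * f ^ (0 + 1) =
      1 + PowerSeries.X * (PowerSeries.C u * (PowerSeries.X ^ 0 * f ^ (0 + 1)) +
        PowerSeries.X ^ 1 * f ^ (1 + 1)) := by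
    linear_combination hf
  rw [motzkinTriangle, h, map_add, PowerSeries.coeff_one, if_neg n.succ_ne_zero, zero_add,
    PowerSeries.coeff_succ_X_mul, map_add, PowerSeries.coeff_C_mul]
  rfl

theorem motzkinTriangle_succ_succ
    (hf : f = 1 + PowerSeries.C u * PowerSeries.X * f + PowerSeries.X ^ 2 * f ^ 2) (n k : ℕ) :
    motzkinTriangle f (n + 1) (k + 1) =
      motzkinTriangle f n k + u * motzkinTriangle f n (k + 1) + motzkinTriangle f n (k + 2) := by
  have h : PowerSeries.X ^ (k + 1) * f ^ (k + 1 + 1) =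
      PowerSeries.X * (PowerSeries.X ^ k * f ^ (k + 1) +
        PowerSeries.C u * (PowerSeries.X ^ (k + 1) * f ^ (k + 1 + 1)) +
        PowerSeries.X ^ (k + 2) * f ^ (k + 2 + 1)) := by
    -- The equation for f multiplied by z^(k+1) f^(k+1).
    linear_combination PowerSeries.X ^ (k + 1) * f ^ (k + 1) * hf
  rw [motzkinTriangle, h, PowerSeries.coeff_succ_X_mul, map_add, map_add, PowerSeries.coeff_C_mul]
  rfl

/-- Summation by parts: the rows of the triangle evolve by a symmetric tridiagonal matrix, which
can be moved over to the other factor `v`, up to a boundary term. -/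
theorem sum_motzkinTriangle_succ_mul
    (hf : f = 1 + PowerSeries.C u * PowerSeries.X * f + PowerSeries.X ^ 2 * f ^ 2)
    {v w : ℕ → R} (h0 : w 0 = u * v 0 + v 1)
    (hs : ∀ k, w (k + 1) = v k + u * v (k + 1) + v (k + 2)) (n N : ℕ) :
    ∑ k ∈ Finset.range (N + 1), motzkinTriangle f (n + 1) k * v k =
      ∑ k ∈ Finset.range (N + 1), motzkinTriangle f n k * w k +
        (motzkinTriangle f n (N + 1) * v N - motzkinTriangle f n N * v (N + 1)) := by
  induction N with
  | zero =>
    simp only [zero_add, Finset.sum_range_one, motzkinTriangle_succ_zero hf, h0]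
    ring
  | succ N ih =>
    rw [Finset.sum_range_succ, ih, Finset.sum_range_succ _ (N + 1),
      motzkinTriangle_succ_succ hf, hs]
    ring

/-- Row n is supported on k ≤ n < N - 1, so both boundary terms vanish. -/
theorem sum_motzkinTriangle_succ_mul_of_lt
    (hf : f = 1 + PowerSeries.C u * PowerSeries.X * f + PowerSeries.X ^ 2 * f ^ 2)
    {v w : ℕ → R} (h0 : w 0 = u * v 0 + v 1)
    (hs : ∀ k, w (k + 1) = v k + u * v (k + 1) + v (k + 2)) {n N : ℕ} (hn : n + 1 < N) :
    ∑ k ∈ Finset.range N, motzkinTriangle f (n + 1) k * v k =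
      ∑ k ∈ Finset.range N, motzkinTriangle f n k * w k := by
  obtain ⟨N, rfl⟩ : ∃ m, N = m + 1 := ⟨N - 1, by omega⟩
  rw [sum_motzkinTriangle_succ_mul hf h0 hs, motzkinTriangle_eq_zero_of_lt (by omega),
    motzkinTriangle_eq_zero_of_lt (by omega)]
  ring

theorem sum_motzkinTriangle_zero_mul
    (hf : f = 1 + PowerSeries.C u * PowerSeries.X * f + PowerSeries.X ^ 2 * f ^ 2)
    (v : ℕ → R) {N : ℕ} (hN : 0 < N) :
    ∑ k ∈ Finset.range N, motzkinTriangle f 0 k * v k = v 0 := by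
  rw [Finset.sum_eq_single_of_mem 0 (Finset.mem_range.2 hN), motzkinTriangle_self hf, one_mul]
  intro k _ hk
  rw [motzkinTriangle_eq_zero_of_lt (Nat.pos_of_ne_zero hk), zero_mul]

/-- J is symmetric, so each step down in i can be traded for a step down in j until i = 0. -/
theorem sum_motzkinTriangle_mul_motzkinTriangle
    (hf : f = 1 + PowerSeries.C u * PowerSeries.X * f + PowerSeries.X ^ 2 * f ^ 2)
    {i N : ℕ} (hi : i < N) (j : ℕ) :
    ∑ k ∈ Finset.range N, motzkinTriangle f i k * motzkinTriangle f j k =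
      PowerSeries.coeff (i + j) f := by
  induction i generalizing j with
  | zero => rw [sum_motzkinTriangle_zero_mul hf _ hi, motzkinTriangle_zero_right, zero_add]
  | succ i ih =>
    rw [sum_motzkinTriangle_succ_mul_of_lt hf (motzkinTriangle_succ_zero hf j)
      (motzkinTriangle_succ_succ hf j) hi, ih (by omega),
      Nat.add_right_comm, Nat.add_assoc]

end Triangle

theorem convPoly_zero_left {R : Type*} [CommSemiring R] (a : ℕ → R) (x : R) :
    convPoly a 0 x = a 0 := by
  simp [convPoly]

theorem convPoly_succ {R : Type*} [CommSemiring R] (a : ℕ → R) (n : ℕ) (x : R) :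
    convPoly a (n + 1) x = a (n + 1) + x * convPoly a n x := by
  rw [convPoly, Finset.sum_range_succ', convPoly, Finset.mul_sum, add_comm]
  congr 1
  · simp
  · refine Finset.sum_congr rfl fun k _ => ?_
    rw [Nat.add_sub_add_right]
    ring

/-- The coordinates of `convPoly` of the Motzkin moments along the rows of the triangle. -/
def motzkinConvCoord {R : Type*} [CommRing R] (u x : R) (k : ℕ) : R :=
  (if k = 0 then 1 else 0) + x * bivFib (x - u) (-1) k

/-- The orthogonal polynomials of the Motzkin moments, evaluated at zero. -/
def motzkinOrthoAtZero {R : Type*} [CommRing R] (u : R) (k : ℕ) : R :=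
  (-1) ^ k * bivFib u (-1) (k + 1)

/-! ### Evaluation of the Hankel determinant -/

section Determinant

variable {R : Type*} [CommRing R] {u : R} {f : PowerSeries R}

theorem bivFib_add_two {R : Type*} [CommSemiring R] (x s : R) (n : ℕ) :
    bivFib x s (n + 2) = x * bivFib x s (n + 1) + s * bivFib x s n := rfl

/-- The vector c satisfies Jc = xc + (row 1 of A), which reproduces the recursion of r in i: pairing
row i with row 1 gives a(i+1). -/
theorem sum_motzkinTriangle_mul_motzkinConvCoord
    (hf : f = 1 + PowerSeries.C u * PowerSeries.X * f + PowerSeries.X ^ 2 * f ^ 2) (x : R)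
    {i N : ℕ} (hi : i < N) :
    ∑ k ∈ Finset.range N, motzkinTriangle f i k * motzkinConvCoord u x k =
      convPoly (fun k => PowerSeries.coeff k f) i x := by
  induction i with
  | zero =>
    rw [sum_motzkinTriangle_zero_mul hf _ hi, convPoly_zero_left,
      PowerSeries.coeff_zero_eq_constantCoeff_apply, constantCoeff_of_motzkin_equation hf]
    simp [motzkinConvCoord, bivFib]
  | succ i ih =>
    have h0 : x * motzkinConvCoord u x 0 + motzkinTriangle f 1 0 =
        u * motzkinConvCoord u x 0 + motzkinConvCoord u x 1 := by
      rw [motzkinTriangle_succ_zero hf, motzkinTriangle_self hf,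
        motzkinTriangle_eq_zero_of_lt zero_lt_one]
      simp only [motzkinConvCoord, bivFib, if_pos, one_ne_zero, if_false]
      ring
    have hs : ∀ k, x * motzkinConvCoord u x (k + 1) + motzkinTriangle f 1 (k + 1) =
        motzkinConvCoord u x k + u * motzkinConvCoord u x (k + 1) +
          motzkinConvCoord u x (k + 2) := by
      intro k
      cases k with
      | zero =>
        rw [zero_add, motzkinTriangle_self hf]
        simp [motzkinConvCoord, bivFib]
        ring
      | succ k =>
        rw [motzkinTriangle_eq_zero_of_lt (by omega)]
        simp only [motzkinConvCoord, Nat.add_eq_zero_iff, one_ne_zero, and_false, if_false,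
          OfNat.ofNat_ne_zero, bivFib_add_two _ _ (k + 1)]
        ring
    rw [sum_motzkinTriangle_succ_mul_of_lt hf
      (w := fun k => x * motzkinConvCoord u x k + motzkinTriangle f 1 k) h0 hs hi, convPoly_succ,
      ← ih (by omega), ← sum_motzkinTriangle_mul_motzkinTriangle hf (by omega : i < N) 1,
      Finset.mul_sum, ← Finset.sum_add_distrib]
    exact Finset.sum_congr rfl fun k _ => by ring

theorem sum_motzkinTriangle_mul_motzkinOrthoAtZero
    (hf : f = 1 + PowerSeries.C u * PowerSeries.X * f + PowerSeries.X ^ 2 * f ^ 2)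
    {i N : ℕ} (hi : i + 1 < N) :
    ∑ k ∈ Finset.range N, motzkinTriangle f (i + 1) k * motzkinOrthoAtZero u k = 0 := by
  rw [sum_motzkinTriangle_succ_mul_of_lt hf (w := fun _ => 0) _ _ hi]
  · simp
  · simp [motzkinOrthoAtZero, bivFib]
  · intro k
    simp only [motzkinOrthoAtZero, bivFib_add_two u (-1 : R) (k + 1)]
    ring

theorem hankelDet_eq_sum
    (hf : f = 1 + PowerSeries.C u * PowerSeries.X * f + PowerSeries.X ^ 2 * f ^ 2)
    (n : ℕ) (x : R) :
    hankelDet (fun k => PowerSeries.coeff k f) n x =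
      ∑ k ∈ Finset.range (n + 1), motzkinConvCoord u x k * motzkinOrthoAtZero u k := by
  set A : Matrix (Fin (n + 1)) (Fin (n + 1)) R :=
    Matrix.of fun i j => motzkinTriangle f i j with hA
  set C : Matrix (Fin (n + 1)) (Fin (n + 1)) R :=
    A.updateRow 0 fun k => motzkinConvCoord u x k with hC
  -- Multiplying by P on the right puts Cp in column 0 and leaves the other columns of C unchanged.
  set P : Matrix (Fin (n + 1)) (Fin (n + 1)) R :=
    (1 : Matrix _ _ R).updateCol 0 fun k => motzkinOrthoAtZero u k with hP
  have detA : A.det = 1 := by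
    rw [Matrix.det_of_isLowerTriangular A]
    · exact Finset.prod_eq_one fun i _ => motzkinTriangle_self hf i
    · intro i j hij
      exact motzkinTriangle_eq_zero_of_lt (by simpa using hij)
  have detP : P.det = 1 := by
    rw [Matrix.det_of_isLowerTriangular P]
    · refine Finset.prod_eq_one fun i _ => ?_
      by_cases hi : i = 0
      · subst hi
        simp [hP, motzkinOrthoAtZero, bivFib]
      · simp [hP, hi]
    · intro i j hij
      have hij' : i < j := by simpa using hij
      have hj : j ≠ 0 := (lt_of_le_of_lt (Fin.zero_le i) hij').ne'
      simp [hP, hj, hij'.ne]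
  have hrow : hankelDet (fun k => PowerSeries.coeff k f) n x = (C * A.transpose).det := by
    refine Matrix.det_eq_of_forall_row_eq_smul_add_pred (fun _ => x) ?_ ?_
    · intro j
      simp only [Matrix.of_apply, Matrix.mul_apply, Matrix.transpose_apply, hC,
        Matrix.updateRow_self, hA, Fin.val_zero, zero_add]
      rw [← sum_motzkinTriangle_mul_motzkinConvCoord hf x j.2, Finset.sum_range]
      exact Finset.sum_congr rfl fun k _ => mul_comm _ _
    · intro i j
      simp only [Matrix.of_apply, Matrix.mul_apply, Matrix.transpose_apply, hC,
        Matrix.updateRow_ne (Fin.succ_ne_zero i), hA, Fin.val_succ, Fin.val_castSucc]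
      rw [Nat.add_right_comm, convPoly_succ, Nat.add_right_comm,
        ← sum_motzkinTriangle_mul_motzkinTriangle hf (Nat.succ_lt_succ i.2), Finset.sum_range]
  have hcol : ∀ i, (C * P) i 0 = ∑ k, C i k * motzkinOrthoAtZero u k := by
    intro i
    simp [Matrix.mul_apply, hP]
  have hne : ∀ i (j : Fin n), (C * P) i j.succ = C i j.succ := by
    intro i j
    simp [Matrix.mul_apply, hP, Matrix.one_apply]
  have hminor : ((C * P).submatrix Fin.succ Fin.succ).det = 1 := by
    have hentry : ∀ i j : Fin n, (C * P).submatrix Fin.succ Fin.succ i j =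
        motzkinTriangle f (i + 1) (j + 1) := by
      intro i j
      rw [Matrix.submatrix_apply, hne, hC, Matrix.updateRow_ne (Fin.succ_ne_zero i)]
      rfl
    rw [Matrix.det_of_isLowerTriangular]
    · exact Finset.prod_eq_one fun i _ => (hentry i i).trans (motzkinTriangle_self hf _)
    · intro i j hij
      have hij' : i < j := by simpa using hij
      exact (hentry i j).trans (motzkinTriangle_eq_zero_of_lt (Nat.succ_lt_succ hij'))
  have hdet : (C * P).det = ∑ k : Fin (n + 1), motzkinConvCoord u x k * motzkinOrthoAtZero u k := by
    -- Column 0 of CP is zero below its top entry c·p.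
    rw [Matrix.det_succ_column_zero, Finset.sum_eq_single_of_mem 0 (Finset.mem_univ _)]
    · rw [Fin.succAbove_zero, hminor, hcol]
      simp [hC]
    · intro i _ hi
      obtain ⟨i, rfl⟩ := Fin.exists_succ_eq.2 hi
      have : (C * P) i.succ 0 = 0 := by
        rw [hcol, ← sum_motzkinTriangle_mul_motzkinOrthoAtZero hf (Nat.succ_lt_succ i.2),
          Finset.sum_range, hC]
        simp only [Matrix.updateRow_ne (Fin.succ_ne_zero i)]
        rfl
      simp [this]
  rw [hrow, Matrix.det_mul, Matrix.det_transpose, detA, mul_one, Finset.sum_range, ← hdet,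
    Matrix.det_mul, detP, mul_one]

theorem sum_motzkinConvCoord_mul_motzkinOrthoAtZero (u x : R) (n : ℕ) :
    ∑ k ∈ Finset.range (n + 1), motzkinConvCoord u x k * motzkinOrthoAtZero u k =
      (-1) ^ n * (bivFib u (-1) (n + 1) * bivFib (x - u) (-1) (n + 1) +
        bivFib u (-1) (n + 2) * bivFib (x - u) (-1) n) := by
  induction n with
  | zero => simp [motzkinConvCoord, motzkinOrthoAtZero, bivFib]
  | succ n ih =>
    rw [Finset.sum_range_succ, ih]
    simp only [motzkinConvCoord, motzkinOrthoAtZero, n.succ_ne_zero, if_false,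
      bivFib_add_two u (-1 : R) (n + 1), bivFib_add_two (x - u) (-1 : R) n,
      bivFib_add_two u (-1 : R) n]
    ring

theorem hankelDet_motzkin
    (hf : f = 1 + PowerSeries.C u * PowerSeries.X * f + PowerSeries.X ^ 2 * f ^ 2)
    (n : ℕ) (x : R) :
    hankelDet (fun k => PowerSeries.coeff k f) n x =
      (-1) ^ n * (bivFib u (-1) (n + 1) * bivFib (x - u) (-1) (n + 1) +
        bivFib u (-1) (n + 2) * bivFib (x - u) (-1) n) := by
  rw [hankelDet_eq_sum hf, sum_motzkinConvCoord_mul_motzkinOrthoAtZero]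

theorem hankelDet_motzkin_zero
    (hf : f = 1 + PowerSeries.C u * PowerSeries.X * f + PowerSeries.X ^ 2 * f ^ 2) (n : ℕ) :
    hankelDet (fun k => PowerSeries.coeff k f) n 0 = 1 := by
  rw [hankelDet_eq_sum hf, Finset.sum_eq_single_of_mem 0 (by simp)]
  · simp [motzkinConvCoord, motzkinOrthoAtZero, bivFib]
  · intro k _ hk
    simp [motzkinConvCoord, hk]

/-! ### The case u = 1 -/

/-- The values run 0, 1, 1, 0, -1, -1 periodically, because F_(k+3) = -F_k at (1, -1); hence the
split modulo 3. -/
theorem bivFib_one_neg_one (R : Type*) [CommRing R] (n : ℕ) :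
    bivFib (1 : R) (-1) (3 * n) = 0 ∧ bivFib (1 : R) (-1) (3 * n + 1) = (-1) ^ n := by
  induction n with
  | zero => simp [bivFib]
  | succ n ih =>
    obtain ⟨h0, h1⟩ := ih
    have h2 := bivFib_add_two (1 : R) (-1) (3 * n)
    have h3 := bivFib_add_two (1 : R) (-1) (3 * n + 1)
    have h4 := bivFib_add_two (1 : R) (-1) (3 * n + 2)
    constructor
    · linear_combination (exp := 1) h3 + h2 - h0
    · rw [pow_succ]
      linear_combination (exp := 1) h4 + h3 - h1

theorem natCast_motzkinNumber (R : Type*) [CommRing R] (n : ℕ) :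
    (motzkinNumber n : R) = motzkinMoment 1 n := by
  rw [motzkinNumber]
  induction n using Nat.strong_induction_on with
  | _ n ih =>
    cases n with
    | zero => simp [motzkinMoment]
    | succ n =>
      rw [motzkinMoment, motzkinMoment, Nat.cast_add, Nat.cast_mul, Nat.cast_one,
        ih n n.lt_succ_self, Nat.cast_sum]
      congr 1
      refine Finset.sum_congr rfl fun i _ => ?_
      rw [Nat.cast_mul, ih i (by omega), ih (n - 1 - i) (by omega)]

theorem hankelDet_motzkinNumber (n : ℕ) (x : R) :
    hankelDet (fun k => (motzkinNumber k : R)) n x =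
      (-1) ^ n * (bivFib 1 (-1) (n + 1) * bivFib (x - 1) (-1) (n + 1) +
        bivFib 1 (-1) (n + 2) * bivFib (x - 1) (-1) n) := by
  rw [← hankelDet_motzkin ((eq_mk_motzkinMoment_iff 1 _).2 rfl)]
  simp only [natCast_motzkinNumber, PowerSeries.coeff_mk]

end Determinant

theorem mainTheorem10 {K : Type*} [Field K] (x : K) :
    (∀ (u : K) (f : PowerSeries K),
      f = 1 + PowerSeries.C u * PowerSeries.X * f + PowerSeries.X ^ 2 * f ^ 2 →
      ∀ n : ℕ,
        hankelDet (fun k => PowerSeries.coeff k f) n 0 ≠ 0 ∧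
        hankelDet (fun k => PowerSeries.coeff k f) n x /
            hankelDet (fun k => PowerSeries.coeff k f) n 0 =
          (-1) ^ n * (bivFib u (-1) (n + 1) * bivFib (x - u) (-1) (n + 1) +
            bivFib u (-1) (n + 2) * bivFib (x - u) (-1) n)) ∧
    (∀ n : ℕ,
      hankelDet (fun k => (motzkinNumber k : K)) (3 * n) x =
          bivFib (x - 1) (-1) (3 * n) + bivFib (x - 1) (-1) (3 * n + 1) ∧
      hankelDet (fun k => (motzkinNumber k : K)) (3 * n + 1) x =
          -bivFib (x - 1) (-1) (3 * n + 2) ∧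
      hankelDet (fun k => (motzkinNumber k : K)) (3 * n + 2) x =
          -bivFib (x - 1) (-1) (3 * n + 2)) := by
  refine ⟨fun u f hf n => ⟨?_, ?_⟩, fun n => ⟨?_, ?_, ?_⟩⟩
  · rw [hankelDet_motzkin_zero hf]
    exact one_ne_zero
  · rw [hankelDet_motzkin_zero hf, div_one, hankelDet_motzkin hf]
  all_goals
    obtain ⟨h0, h1⟩ := bivFib_one_neg_one K n
    obtain ⟨h3, h4⟩ := bivFib_one_neg_one K (n + 1)
    have h2 : bivFib (1 : K) (-1) (3 * n + 2) = (-1) ^ n := by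
      rw [bivFib_add_two, h0, h1]
      ring
    have hsq : ((-1 : K) ^ n) * (-1) ^ n = 1 := by rw [← mul_pow]; simp
    have hcube : (-1 : K) ^ (3 * n) = (-1) ^ n := by rw [pow_mul]; norm_num
    rw [hankelDet_motzkinNumber]
  · rw [h1, h2, hcube]
    linear_combination
      (bivFib (x - 1) (-1) (3 * n) + bivFib (x - 1) (-1) (3 * n + 1)) * hsq
  · rw [show 3 * n + 1 + 2 = 3 * (n + 1) by ring, h3, h2, pow_succ, hcube]
    linear_combination -bivFib (x - 1) (-1) (3 * n + 2) * hsq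
  · rw [show 3 * n + 2 + 1 = 3 * (n + 1) by ring,
      show 3 * n + 2 + 2 = 3 * (n + 1) + 1 by ring, h3, h4, pow_add, hcube, pow_succ]
    linear_combination -bivFib (x - 1) (-1) (3 * n + 2) * hsq
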